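/- **Setting.** Let $\mathcal D$ be a finite non-empty set of users and $\mathcal F$ a finite non-empty set of channels. An action profile is $a=(a_i)_{i\in\mathcal D}\in X=\mathcal F^{\mathcal D}$, and $\mathcal D(c)=\{j: a_j=c\}$ is the set of users on channel $c$. The data rate of a user depends on its channel and on the set of users on this channel. The $k$-th measurement ($k=1,2,\dots$) yields real random rates $\hat\nu_{j,k}(c,S)$ (rate of user $j\in S$ on channel $c$ if exactly the users in $S$ transmit on $c$) with finite expectation; the measurements are i.i.d. in $k$, with arbitrary dependence within one measurement. The potential is the expected sum rate $$\phi(a)=\mathbb E\Big[\sum_{j\in\mathcal D}\hat\nu_{j}\big(a_j,\mathcal D(a_j)\big)\Big],$$ and the utility of player $i$ is its marginal contribution $$\hat U_{i,k}(a)=\sum_{j\in\mathcal D(a_i)}\hat\nu_{j,k}\big(a_i,\mathcal D(a_i)\big)-\sum_{j\in\mathcal D(a_i)\setminus i}\hat\nu_{j,k}\big(a_i,\mathcal D(a_i)\setminus i\big),\qquad U_i=\mathbb E[\hat U_{i,k}],\qquad \hat U_i^N=\frac1N\sum_{k=1}^N\hat U_{i,k}.$$ For a unilateral deviation from $a$ to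 $b=(\hat a_i,a_{-i})$, $\hat a_i\ne a_i$, the estimation noise is $Z=\hat U_{i,k}(a)-U_i(a)-(\hat U_{i,k}(b)-U_i(b))$. Binary Log-linear Learning (BLLA) at temperature $\tau>0$ with $N=N(\tau)\ge1$ samples is the following Markov chain on $X$: in state $a$, draw a player $i$ and a trial action $\hat a_i\in\mathcal F$ uniformly at random, move to $(\hat a_i,a_{-i})$ with probability $\mathbb E\big[(1+e^{\Delta_i^N/\tau})^{-1}\big]$, where $\Delta_i^N=\hat U_i^N(a)-\hat U_i^N(\hat a_i,a_{-i})$ is computed from fresh samples, and otherwise stay at $a$. A state is *stochastically stable* if its stationary probability has a strictly positive limit as $\tau\to0^+$. A number $R\ge0$ is the *resistance* of a transition with probability $P^\tau$ if $0<\lim_{\tau\to0^+}P^\tau/e^{-R/\tau}<\infty$. **Theorem.** Let $0<\xi<1$, and suppose that one of the following holds for all sufficiently small $\tau>0$. 1. (Bounded noise.) There is $\ell$ such that for every deviation the noise lies almost surely in an interval of length $\ell$, and $$N(\tau)\ \ge\ \Big(\log\frac4\xi+\frac2\tau\Big)\frac{\ell^2}{2(1-\xi)^2\tau^2}.$$ 2.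 (Noise with a moment generating function.) For every deviation the moment generating function $M(\theta)=\mathbb E[e^{\theta Z}]$ is finite for all $\theta\in\mathbb R$, the function $\theta\mapsto\theta(1-\xi)\tau-\log M(\theta)$ attains its maximum over $\mathbb R$ at some $\theta^*$, and $$N(\tau)\ \ge\ \frac{\log\frac4\xi+\frac2\tau}{\log\big(e^{\theta^*(1-\xi)\tau}/M(\theta^*)\big)}$$ ($M$ and $\theta^*$ may depend on the deviation, in which case the bound is required for each of them). Then for every $\tau>0$ the chain has a unique stationary distribution, these distributions converge as $\tau\to0^+$, and the stochastically stable states are exactly the global maximizers of $\phi$ over $X$. Moreover, every transition from $a$ to $b=(\hat a_i,a_{-i})$ with $\hat a_i\neq a_i$ has resistance $\max\{0,U_i(a)-U_i(b)\}$, which is also its resistance in the noiseless case, where the acceptance probability is $(1+e^{(U_i(a)-U_i(b))/\tau})^{-1}$. -/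

import Mathlib

open MeasureTheory ProbabilityTheory Filter Topology

namespace BLLA

noncomputable section

/-! ### The channel assignment game

`D` is the finite set of user equipments (the players) and `F` the finite set of channels.
An action profile is a map `a : D → F`.  The data rate of user `j` is determined by its channel
`c` and by the set `S` of users on that channel: a table of rates is a function `r`, where
`r j c S` is the data rate of `j ∈ S` on `c` when exactly the users of `S` transmit on `c`
(the values at `j ∉ S` are never used). -/

/-- The set of users that transmit on channel `c` under the profile `a`. -/
def users {D F : Type*} [Fintype D] [DecidableEq F] (a : D → F) (c : F) : Finset D :=
  Finset.univ.filter (fun j => a j = c)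

/-- Sum of the data rates of all users under the profile `a`. -/
def sumRate {D F : Type*} [Fintype D] [DecidableEq F]
    (r : D → F → Finset D → ℝ) (a : D → F) : ℝ :=
  ∑ j, r j (a j) (users a (a j))

/-- Marginal contribution of player `i`: the total rate on the channel of `i`,
minus the total rate that the other users of this channel have when `i` is absent. -/
def marginal {D F : Type*} [Fintype D] [DecidableEq D] [DecidableEq F]
    (r : D → F → Finset D → ℝ) (i : D) (a : D → F) : ℝ :=
  (∑ j ∈ users a (a i), r j (a i) (users a (a i)))
    - ∑ j ∈ (users a (a i)).erase i, r j (a i) ((users a (a i)).erase i)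

section Random

variable {D F Ω : Type*} [Fintype D] [DecidableEq D] [DecidableEq F] [MeasurableSpace Ω]

/-- The potential: the expected sum data rate.  Here `rate k ω` is the table of data rates
measured in the `k`-th sample. -/
def potential (μ : Measure Ω) (rate : ℕ → Ω → D → F → Finset D → ℝ) (a : D → F) : ℝ :=
  ∫ ω, sumRate (rate 0 ω) a ∂μ

/-- The expected utility of player `i`. -/
def meanUtility (μ : Measure Ω) (rate : ℕ → Ω → D → F → Finset D → ℝ)
    (i : D) (a : D → F) : ℝ :=
  ∫ ω, marginal (rate 0 ω) i a ∂μ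

/-- The utility of player `i` estimated from `N` samples. -/
def sampleUtility (rate : ℕ → Ω → D → F → Finset D → ℝ) (N : ℕ)
    (i : D) (a : D → F) (ω : Ω) : ℝ :=
  (1 / (N : ℝ)) * ∑ k ∈ Finset.range N, marginal (rate k ω) i a

/-- Estimation noise in the `k`-th sample, for the comparison of the profile `a` with the
profile in which player `i` switches to the trial action `c`. -/
def noise (μ : Measure Ω) (rate : ℕ → Ω → D → F → Finset D → ℝ)
    (k : ℕ) (i : D) (a : D → F) (c : F) (ω : Ω) : ℝ :=
  (marginal (rate k ω) i a - meanUtility μ rate i a)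
    - (marginal (rate k ω) i (Function.update a i c)
        - meanUtility μ rate i (Function.update a i c))

/-- Probability that the trial action `c` of player `i` is selected at the profile `a`, when the
comparison is based on `N` fresh estimation samples and the temperature is `τ`. -/
def noisyAccept (μ : Measure Ω) (rate : ℕ → Ω → D → F → Finset D → ℝ) (N : ℕ) (τ : ℝ)
    (i : D) (a : D → F) (c : F) : ℝ :=
  ∫ ω, (1 + Real.exp ((sampleUtility rate N i a ω
      - sampleUtility rate N i (Function.update a i c) ω) / τ))⁻¹ ∂μ

/-- The same probability in the noiseless game with the expected utilities. -/
def exactAccept (μ : Measure Ω) (rate : ℕ → Ω → D → F → Finset D → ℝ) (τ : ℝ)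
    (i : D) (a : D → F) (c : F) : ℝ :=
  (1 + Real.exp ((meanUtility μ rate i a
      - meanUtility μ rate i (Function.update a i c)) / τ))⁻¹

/-- Bounded noise: for every deviation the noise lies almost surely in an interval of length `ℓ`,
and the number of samples is at least the stated bound for all small temperatures. -/
def BoundedNoiseCondition (μ : Measure Ω) (rate : ℕ → Ω → D → F → Finset D → ℝ)
    (ξ : ℝ) (N : ℝ → ℕ) (ℓ : ℝ) : Prop :=
  (∀ (i : D) (a : D → F) (c : F), c ≠ a i →
      ∃ α : ℝ, ∀ᵐ ω ∂μ, noise μ rate 0 i a c ω ∈ Set.Icc α (α + ℓ)) ∧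
  ∀ᶠ τ in 𝓝[>] (0 : ℝ),
    (Real.log (4 / ξ) + 2 / τ) * (ℓ ^ 2 / (2 * (1 - ξ) ^ 2 * τ ^ 2)) ≤ (N τ : ℝ)

/-- Noise with a finite moment generating function `M`: for all small temperatures the number of
samples is at least the stated bound at a maximizer `θ` of `θ (1 - ξ) τ - log M(θ)`.  The law of
the noise, and with it `M` and `θ`, may vary with the deviation; the bound is required for each. -/
def MGFNoiseCondition (μ : Measure Ω) (rate : ℕ → Ω → D → F → Finset D → ℝ)
    (ξ : ℝ) (N : ℝ → ℕ) : Prop :=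
  ∀ (i : D) (a : D → F) (c : F), c ≠ a i →
    (∀ θ : ℝ, Integrable (fun ω => Real.exp (θ * noise μ rate 0 i a c ω)) μ) ∧
    ∀ᶠ τ in 𝓝[>] (0 : ℝ), ∃ θ : ℝ,
      (∀ θ' : ℝ, θ' * (1 - ξ) * τ - Real.log (mgf (noise μ rate 0 i a c) μ θ')
          ≤ θ * (1 - ξ) * τ - Real.log (mgf (noise μ rate 0 i a c) μ θ)) ∧
      (Real.log (4 / ξ) + 2 / τ)
          / Real.log (Real.exp (θ * (1 - ξ) * τ) / mgf (noise μ rate 0 i a c) μ θ)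
        ≤ (N τ : ℝ)

end Random

/-! ### The Markov chain -/

/-- Transition matrix of binary log-linear learning: a player `i` and a trial action `c` are drawn
uniformly, player `i` switches to `c` with probability `accept i a c` and keeps its action
otherwise, and the other players repeat their actions. -/
def chain {D F : Type*} [Fintype D] [DecidableEq D] [Fintype F] [DecidableEq F]
    (accept : D → (D → F) → F → ℝ) : Matrix (D → F) (D → F) ℝ :=
  fun a b => ∑ i : D, ∑ c : F,
    (1 / ((Fintype.card D : ℝ) * (Fintype.card F : ℝ))) *
      (accept i a c * (if b = Function.update a i c then 1 else 0)
        + (1 - accept i a c) * (if b = a then 1 else 0))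

/-- `p` is a stationary distribution of the transition matrix `P`. -/
def IsStationary {X : Type*} [Fintype X] (P : Matrix X X ℝ) (p : X → ℝ) : Prop :=
  p ∈ stdSimplex ℝ X ∧ Matrix.vecMul p P = p

/-- A state is stochastically stable if its stationary probability has a strictly positive limit
as the temperature goes to zero. -/
def StochasticallyStable {X : Type*} [Fintype X] (P : ℝ → Matrix X X ℝ) (x : X) : Prop :=
  ∃ p : ℝ → X → ℝ, (∀ τ, 0 < τ → IsStationary (P τ) (p τ)) ∧
    ∃ L : ℝ, 0 < L ∧ Tendsto (fun τ => p τ x) (𝓝[>] (0 : ℝ)) (𝓝 L)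

/-- `R ≥ 0` is the resistance of `f` if `f(τ) / exp (-R / τ)` has a limit in `(0, ∞)`
as `τ → 0+`. -/
def HasResistance (f : ℝ → ℝ) (R : ℝ) : Prop :=
  0 ≤ R ∧ ∃ L : ℝ, 0 < L ∧
    Tendsto (fun τ => f τ / Real.exp (-R / τ)) (𝓝[>] (0 : ℝ)) (𝓝 L)

end

end BLLA

/-! The sum rate minus the marginal contribution of `i` is the sum rate of the others in the absence
of `i`, so it does not depend on the action of `i`. Hence utility differences under unilateral
deviations are differences of φ, and the noiseless chain is reversible with respect to the Gibbs
weights exp(φ/τ).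

Noise replaces Δ by Δ + V in the logistic function, where V is the averaged noise. If E exp(±V/τ) →
1, then Jensen's inequality and (1 + exp x)⁻¹ ≤ exp(-x) make the acceptance probability asymptotic
to exp(-max(0,Δ)/τ), times 1/2 if Δ = 0 (`tendsto_integral_logistic_div_exp`). By independence E
exp(±V/τ) = M(±1/(Nτ))^N, and M(u) ≤ 1 + Cu² near 0 for centered noise, so Nτ² → ∞ suffices. Bounded
noise of nonzero range has N of order at least τ⁻³. In the other case the denominator of the bound
is the Legendre transform of log M at (1-ξ)τ, which is o(τ) for nondegenerate noise
(`eventually_rate_pos_and_le`).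

The limiting factor is the same in both directions of a deviation, so detailed balance with exp(φ/τ)
holds up to any factor ρ > 1 once τ is small. By `IsStationary.mul_le_of_almost_reversible` this
distorts ratios of stationary probabilities by at most ρ^|X|. The stationary and Gibbs distributions
therefore have the same limits, without any minimal-tree argument. -/

namespace BLLA

set_option linter.unusedSectionVars false

/-! ### Stationary distributions of finite chains -/

section FiniteChain

variable {X : Type*} [Fintype X] {P : Matrix X X ℝ}

/-- Every nontrivial cut of the state space is crossed by a transition of positive probability. -/
def CrossesCuts (P : Matrix X X ℝ) : Prop :=
  ∀ S : Finset X, S.Nonempty → S ≠ Finset.univ → ∃ a ∈ S, ∃ b ∉ S, 0 < P a b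

theorem vecMul_apply_sum (p : X → ℝ) (b : X) : Matrix.vecMul p P b = ∑ a, p a * P a b := rfl

/-- If the support is a proper nonempty set, some transition leaves it, and invariance pushes
positive mass onto a point outside the support. -/
theorem eq_zero_or_pos_of_vecMul_eq (hP : ∀ a b, 0 ≤ P a b) (hc : CrossesCuts P)
    {r : X → ℝ} (hr : ∀ a, 0 ≤ r a) (h : Matrix.vecMul r P = r) :
    r = 0 ∨ ∀ a, 0 < r a := by
  classical
  by_contra! hcon
  obtain ⟨h0, z, hz⟩ := hcon
  obtain ⟨y, hy⟩ := Function.ne_iff.1 h0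
  obtain ⟨a, ha, b, hb, hab⟩ := hc (Finset.univ.filter fun x => 0 < r x)
    ⟨y, by simpa using lt_of_le_of_ne (hr y) (Ne.symm hy)⟩
    (fun hu => by
      have := hu ▸ Finset.mem_univ z
      simp only [Finset.mem_filter, Finset.mem_univ, true_and] at this
      exact absurd this (not_lt.2 hz))
  simp only [Finset.mem_filter, Finset.mem_univ, true_and, not_lt] at ha hb
  have h1 : r b = ∑ x, r x * P x b := by rw [← vecMul_apply_sum, h]
  have h2 : r a * P a b ≤ ∑ x, r x * P x b :=
    Finset.single_le_sum (f := fun x => r x * P x b)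
      (fun x _ => mul_nonneg (hr x) (hP x b)) (Finset.mem_univ a)
  have := mul_pos ha hab
  linarith

theorem sum_vecMul (hsum : ∀ a, ∑ b, P a b = 1) (r : X → ℝ) :
    ∑ b, Matrix.vecMul r P b = ∑ a, r a := by
  simp_rw [vecMul_apply_sum]
  rw [Finset.sum_comm]
  simp_rw [← Finset.mul_sum, hsum, mul_one]

theorem IsStationary.pos (hP : ∀ a b, 0 ≤ P a b) (hc : CrossesCuts P)
    {p : X → ℝ} (hp : IsStationary P p) (a : X) : 0 < p a := by
  rcases eq_zero_or_pos_of_vecMul_eq hP hc hp.1.1 hp.2 with h | h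
  · have := hp.1.2
    simp [h] at this
  · exact h a

/-- `P - 1` kills the constants, so it also has a left null vector `v`. The triangle inequality
gives |v| ≤ |v|P entrywise; both sides have the same total, so |v| is invariant. -/
theorem exists_isStationary [Nonempty X] (hP : ∀ a b, 0 ≤ P a b) (hsum : ∀ a, ∑ b, P a b = 1) :
    ∃ p, IsStationary P p := by
  classical
  have hdet : (P - 1).det = 0 := by
    refine Matrix.exists_mulVec_eq_zero_iff.1 ⟨fun _ => 1, ?_, ?_⟩
    · exact Function.ne_iff.2 ⟨Classical.arbitrary X, one_ne_zero⟩
    · ext a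
      simp [Matrix.mulVec, dotProduct, hsum, Matrix.one_apply]
  obtain ⟨v, hv0, hv⟩ := Matrix.exists_vecMul_eq_zero_iff.2 hdet
  rw [Matrix.vecMul_sub, Matrix.vecMul_one, sub_eq_zero] at hv
  have hle : ∀ b, |v b| ≤ Matrix.vecMul (fun a => |v a|) P b := by
    intro b
    conv_lhs => rw [← hv]
    rw [vecMul_apply_sum, vecMul_apply_sum]
    refine (Finset.abs_sum_le_sum_abs _ _).trans (le_of_eq ?_)
    exact Finset.sum_congr rfl fun a _ => by rw [abs_mul, abs_of_nonneg (hP a b)]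
  have heq : Matrix.vecMul (fun a => |v a|) P = fun a => |v a| := by
    have := (Finset.sum_eq_sum_iff_of_le fun b (_ : b ∈ Finset.univ) => hle b).1
      (sum_vecMul hsum _).symm
    ext b
    exact (this b (Finset.mem_univ b)).symm
  obtain ⟨y, hy⟩ := Function.ne_iff.1 hv0
  have hs : 0 < ∑ a, |v a| :=
    Finset.sum_pos' (fun a _ => abs_nonneg _) ⟨y, Finset.mem_univ y, abs_pos.2 hy⟩
  refine ⟨(∑ a, |v a|)⁻¹ • fun a => |v a|, ⟨fun a => ?_, ?_⟩, ?_⟩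
  · exact mul_nonneg (inv_nonneg.2 hs.le) (abs_nonneg _)
  · simp only [Pi.smul_apply, smul_eq_mul, ← Finset.mul_sum]
    exact inv_mul_cancel₀ hs.ne'
  · rw [Matrix.smul_vecMul, heq]

theorem IsStationary.unique [Nonempty X] (hP : ∀ a b, 0 ≤ P a b) (hc : CrossesCuts P)
    {p q : X → ℝ} (hp : IsStationary P p) (hq : IsStationary P q) : p = q := by
  -- With t the minimum of p/q, the vector p - tq is nonnegative, invariant and zero at `z`, hence
  -- identically zero.
  obtain ⟨z, hz⟩ := Finite.exists_min fun a => p a / q a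
  have hqpos := hq.pos hP hc
  set t := p z / q z with ht
  have hr : p - t • q = 0 := by
    refine (eq_zero_or_pos_of_vecMul_eq hP hc (r := p - t • q) (fun a => ?_) ?_).resolve_right
      fun h => ?_
    · have := (le_div_iff₀ (hqpos a)).1 (hz a)
      simpa using this
    · rw [Matrix.sub_vecMul, Matrix.smul_vecMul, hp.2, hq.2]
    · have := h z
      simp [ht, div_mul_cancel₀ _ (hqpos z).ne'] at this
  have hpq : p = t • q := sub_eq_zero.1 hr
  have h1 : (∑ a, p a) = t * ∑ a, q a := by
    rw [Finset.mul_sum]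
    exact Finset.sum_congr rfl fun a _ => congrFun hpq a
  rw [hp.1.2, hq.1.2, mul_one] at h1
  rw [hpq, ← h1, one_smul]

/-- Under a stationary distribution the probability flows across a cut balance. -/
theorem IsStationary.cut_balance [DecidableEq X] (hsum : ∀ a, ∑ b, P a b = 1)
    {p : X → ℝ} (hp : IsStationary P p) (S : Finset X) :
    ∑ a ∈ S, ∑ b ∈ Sᶜ, p a * P a b = ∑ a ∈ S, ∑ b ∈ Sᶜ, p b * P b a := by
  have h1 : ∑ a ∈ S, ∑ b, p a * P a b = ∑ a ∈ S, p a := by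
    simp_rw [← Finset.mul_sum, hsum, mul_one]
  have h2 : ∑ a ∈ S, ∑ b, p b * P b a = ∑ a ∈ S, p a :=
    Finset.sum_congr rfl fun a _ => by rw [← vecMul_apply_sum, hp.2]
  have h3 : ∑ a ∈ S, ∑ b ∈ S, p a * P a b = ∑ a ∈ S, ∑ b ∈ S, p b * P b a := Finset.sum_comm
  have hsplit : ∀ f : X → X → ℝ, ∑ a ∈ S, ∑ b, f a b
      = ∑ a ∈ S, ∑ b ∈ S, f a b + ∑ a ∈ S, ∑ b ∈ Sᶜ, f a b := fun f => by
    rw [← Finset.sum_add_distrib]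
    exact Finset.sum_congr rfl fun a _ => (Finset.sum_add_sum_compl S _).symm
  rw [hsplit] at h1 h2
  linarith

/-- A chain that is in detailed balance with `g` up to factors `ρ` has a stationary distribution
that is proportional to `g` up to a power of `ρ`. -/
theorem IsStationary.mul_le_of_almost_reversible (hP : ∀ a b, 0 ≤ P a b)
    (hsum : ∀ a, ∑ b, P a b = 1) (hc : CrossesCuts P) {g : X → ℝ} (hg : ∀ a, 0 < g a)
    {ρ : ℝ} (hρ : 1 ≤ ρ) (hbal : ∀ a b, a ≠ b → g b * P b a ≤ ρ * (g a * P a b))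
    {p : X → ℝ} (hp : IsStationary P p) (a b : X) :
    p a * g b ≤ ρ ^ Fintype.card X * (p b * g a) := by
  classical
  set h : X → ℝ := fun x => p x / g x with hh
  have hρ0 : 0 < ρ := by linarith
  have hpp := hp.pos hP hc
  have hpos : ∀ x, 0 < h x := fun x => div_pos (hpp x) (hg x)
  -- Sublevel sets of the density p/g at geometric thresholds, starting from its value at `b`.
  let S : ℕ → Finset X := fun k => Finset.univ.filter fun x => h x ≤ ρ ^ k * h b
  have hmem : ∀ k x, x ∈ S k ↔ h x ≤ ρ ^ k * h b := fun k x => by simp [S]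
  have hmono : ∀ k, S k ⊆ S (k + 1) := fun k x hx => by
    rw [hmem] at hx ⊢
    refine hx.trans (mul_le_mul_of_nonneg_right ?_ (hpos b).le)
    exact pow_le_pow_right₀ hρ (Nat.le_succ k)
  have hb : ∀ k, b ∈ S k := fun k => by
    rw [hmem]
    exact le_mul_of_one_le_left (hpos b).le (one_le_pow₀ hρ)
  -- If two consecutive levels coincide, the density jumps by more than ρ across the cut. This beats
  -- the allowed imbalance ρ, so more mass leaves the upper side than enters it, against
  -- `cut_balance`.
  have hgrow : ∀ k, S k ≠ Finset.univ → S k ≠ S (k + 1) := by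
    intro k hk heq
    have hne : (S k)ᶜ.Nonempty := by
      rwa [Finset.nonempty_iff_ne_empty, Ne, Finset.compl_eq_empty_iff]
    have hgap : ∀ x ∈ (S k)ᶜ, ∀ y ∈ S k, ρ * h y < h x := by
      intro x hx y hy
      rw [heq, Finset.mem_compl, hmem, not_le] at hx
      rw [hmem] at hy
      have := mul_le_mul_of_nonneg_left hy hρ0.le
      calc ρ * h y ≤ ρ * (ρ ^ k * h b) := this
        _ = ρ ^ (k + 1) * h b := by ring
        _ < h x := hx
    have hflow : ∀ x ∈ (S k)ᶜ, ∀ y ∈ S k,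
        p y * P y x ≤ p x * P x y ∧ (0 < P x y → p y * P y x < p x * P x y) := by
      intro x hx y hy
      have hxy : x ≠ y := fun e => (Finset.mem_compl.1 hx) (e ▸ hy)
      have e1 : p x = h x * g x := by rw [hh]; exact (div_mul_cancel₀ _ (hg x).ne').symm
      have e2 : p y = h y * g y := by rw [hh]; exact (div_mul_cancel₀ _ (hg y).ne').symm
      have b1 : p y * P y x ≤ (ρ * h y) * (g x * P x y) := by
        rw [e2, mul_assoc]
        calc h y * (g y * P y x) ≤ h y * (ρ * (g x * P x y)) :=
              mul_le_mul_of_nonneg_left (hbal x y hxy) (hpos y).le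
          _ = _ := by ring
      have b2 := hgap x hx y hy
      constructor
      · refine b1.trans ?_
        rw [e1, mul_assoc (h x)]
        exact mul_le_mul_of_nonneg_right b2.le (mul_nonneg (hg x).le (hP x y))
      · intro hpos'
        refine b1.trans_lt ?_
        rw [e1, mul_assoc (h x)]
        exact mul_lt_mul_of_pos_right b2 (mul_pos (hg x) hpos')
    obtain ⟨x, hx, y, hy, hxy⟩ := hc (S k)ᶜ hne (fun hu => by
      have := hu ▸ Finset.mem_univ b
      exact Finset.mem_compl.1 this (hb k))
    have hy' : y ∈ S k := by simpa using hy
    have hbalance := hp.cut_balance hsum (S k)ᶜ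
    rw [compl_compl] at hbalance
    refine absurd hbalance (ne_of_gt ?_)
    refine Finset.sum_lt_sum (fun u hu => Finset.sum_le_sum fun v hv => (hflow u hu v hv).1)
      ⟨x, hx, Finset.sum_lt_sum (fun v hv => (hflow x hx v hv).1)
        ⟨y, hy', (hflow x hx y hy').2 hxy⟩⟩
  -- Each level gains a state until all are reached, so |X| steps suffice.
  have hcard : ∀ k, S k = Finset.univ ∨ k < (S k).card := by
    intro k
    induction k with
    | zero => exact Or.inr (Finset.card_pos.2 ⟨b, hb 0⟩)
    | succ k ih =>
      by_cases hk : S k = Finset.univ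
      · exact Or.inl (Finset.univ_subset_iff.1 (hk ▸ hmono k))
      · have := Finset.card_lt_card ((hmono k).ssubset_of_ne (hgrow k hk))
        have := ih.resolve_left hk
        exact Or.inr (by omega)
  have huniv : S (Fintype.card X) = Finset.univ :=
    (hcard _).resolve_right (not_lt.2 (Finset.card_le_univ _))
  have hfin : h a ≤ ρ ^ Fintype.card X * h b := (hmem _ _).1 (huniv ▸ Finset.mem_univ a)
  simp only [hh] at hfin
  rw [div_le_iff₀ (hg a)] at hfin
  have := mul_le_mul_of_nonneg_right hfin (hg b).le
  refine this.trans (le_of_eq ?_)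
  have := (hg b).ne'
  field_simp

end FiniteChain

/-! ### Zero-temperature limits -/

/-- Boltzmann weights normalized at `a` have a limit as the temperature goes to zero, which is
positive exactly when `a` maximizes the potential. -/
theorem exists_tendsto_gibbs {X : Type*} [Fintype X] (φ : X → ℝ) (a : X) :
    ∃ L : ℝ, Tendsto (fun τ => Real.exp (φ a / τ) / ∑ b, Real.exp (φ b / τ)) (𝓝[>] (0 : ℝ)) (𝓝 L) ∧
      (0 < L ↔ ∀ b, φ b ≤ φ a) := by
  classical
  have hinv : Tendsto (fun τ : ℝ => τ⁻¹) (𝓝[>] 0) atTop := tendsto_inv_nhdsGT_zero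
  have hrew : (fun τ => Real.exp (φ a / τ) / ∑ b, Real.exp (φ b / τ))
      = fun τ => (∑ b, Real.exp ((φ b - φ a) * τ⁻¹))⁻¹ := by
    ext τ
    have : ∑ b, Real.exp (φ b / τ)
        = Real.exp (φ a / τ) * ∑ b, Real.exp ((φ b - φ a) * τ⁻¹) := by
      rw [Finset.mul_sum]
      refine Finset.sum_congr rfl fun b _ => ?_
      rw [← Real.exp_add]
      congr 1
      ring
    rw [this, div_mul_eq_div_div, div_self (Real.exp_pos _).ne', one_div]
  rw [hrew]
  -- At a maximizer each summand is 1 or tends to 0, and the limit is the inverse of the number of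
  -- maximizers. Otherwise one summand diverges.
  by_cases hmax : ∀ b, φ b ≤ φ a
  · have hlim : Tendsto (fun τ : ℝ => ∑ b, Real.exp ((φ b - φ a) * τ⁻¹)) (𝓝[>] 0)
        (𝓝 (∑ b, if φ b = φ a then 1 else 0)) := by
      refine tendsto_finsetSum _ fun b _ => ?_
      split_ifs with h
      · simp [h]
      · exact Real.tendsto_exp_atBot.comp
          (hinv.const_mul_atTop_of_neg (sub_neg.2 (lt_of_le_of_ne (hmax b) h)))
    have hpos : (0 : ℝ) < ∑ b, if φ b = φ a then 1 else 0 :=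
      Finset.sum_pos' (fun b _ => by split_ifs <;> norm_num) ⟨a, Finset.mem_univ a, by simp⟩
    exact ⟨_, hlim.inv₀ hpos.ne', by simpa [hmax] using hpos⟩
  · have hmax' := hmax
    push Not at hmax'
    obtain ⟨b, hb⟩ := hmax'
    refine ⟨0, Tendsto.inv_tendsto_atTop ?_, by simpa using hmax⟩
    refine tendsto_atTop_mono (fun τ => ?_)
      (Real.tendsto_exp_atTop.comp (hinv.const_mul_atTop (sub_pos.2 hb)))
    exact Finset.single_le_sum (f := fun b => Real.exp ((φ b - φ a) * τ⁻¹))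
      (fun _ _ => (Real.exp_pos _).le) (Finset.mem_univ b)

/-- The stationary distributions of chains that are asymptotically in detailed balance with the
Boltzmann weights have the same limits as the Gibbs distributions. -/
theorem tendsto_stationary_of_asymptotically_reversible {X : Type*} [Fintype X] [Nonempty X]
    {P : ℝ → Matrix X X ℝ} (φ : X → ℝ)
    (hP : ∀ τ, 0 < τ → ∀ a b, 0 ≤ P τ a b) (hsum : ∀ τ, 0 < τ → ∀ a, ∑ b, P τ a b = 1)
    (hc : ∀ τ, 0 < τ → CrossesCuts (P τ))
    (hbal : ∀ ρ : ℝ, 1 < ρ → ∀ a b, a ≠ b → ∀ᶠ τ in 𝓝[>] (0 : ℝ),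
      Real.exp (φ b / τ) * P τ b a ≤ ρ * (Real.exp (φ a / τ) * P τ a b))
    {p : ℝ → X → ℝ} (hp : ∀ τ, 0 < τ → IsStationary (P τ) (p τ)) (a : X) {L : ℝ}
    (hL : Tendsto (fun τ => Real.exp (φ a / τ) / ∑ b, Real.exp (φ b / τ)) (𝓝[>] (0 : ℝ)) (𝓝 L)) :
    Tendsto (fun τ => p τ a) (𝓝[>] (0 : ℝ)) (𝓝 L) := by
  set G : ℝ → ℝ := fun τ => Real.exp (φ a / τ) / ∑ b, Real.exp (φ b / τ) with hG
  have hS : ∀ τ : ℝ, 0 < ∑ b, Real.exp (φ b / τ) := fun τ =>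
    Finset.sum_pos (fun b _ => Real.exp_pos _) Finset.univ_nonempty
  have hG0 : ∀ τ, 0 < G τ := fun τ => div_pos (Real.exp_pos _) (hS τ)
  have hratio : Tendsto (fun τ => p τ a / G τ) (𝓝[>] (0 : ℝ)) (𝓝 1) := by
    -- Summing the pairwise bounds over the second state turns them into bounds on p/G, as p has
    -- total mass 1.
    have key : ∀ ρ : ℝ, 1 < ρ → ∀ᶠ τ in 𝓝[>] (0 : ℝ),
        p τ a / G τ ≤ ρ ^ Fintype.card X ∧ (ρ ^ Fintype.card X)⁻¹ ≤ p τ a / G τ := by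
      intro ρ hρ
      have hall : ∀ᶠ τ in 𝓝[>] (0 : ℝ), ∀ a b, a ≠ b →
          Real.exp (φ b / τ) * P τ b a ≤ ρ * (Real.exp (φ a / τ) * P τ a b) :=
        eventually_all.2 fun a => eventually_all.2 fun b =>
          eventually_imp_distrib_left.2 (hbal ρ hρ a b)
      filter_upwards [hall, self_mem_nhdsWithin] with τ hτ (hτ0 : 0 < τ)
      have hrev := (hp τ hτ0).mul_le_of_almost_reversible (hP τ hτ0) (hsum τ hτ0) (hc τ hτ0)
        (g := fun x => Real.exp (φ x / τ)) (fun _ => Real.exp_pos _) hρ.le hτ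
      have hK : 0 < ρ ^ Fintype.card X := by positivity
      have h1 : p τ a * ∑ b, Real.exp (φ b / τ) ≤ ρ ^ Fintype.card X * Real.exp (φ a / τ) := by
        have := Finset.sum_le_sum fun b (_ : b ∈ Finset.univ) => hrev a b
        rw [← Finset.mul_sum, ← Finset.mul_sum, ← Finset.sum_mul, (hp τ hτ0).1.2, one_mul] at this
        exact this
      have h2 : Real.exp (φ a / τ) ≤ ρ ^ Fintype.card X * (p τ a * ∑ b, Real.exp (φ b / τ)) := by
        have := Finset.sum_le_sum fun b (_ : b ∈ Finset.univ) => hrev b a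
        rw [← Finset.mul_sum, ← Finset.mul_sum, ← Finset.sum_mul, (hp τ hτ0).1.2, one_mul] at this
        exact this
      constructor
      · rw [div_le_iff₀ (hG0 τ), hG, mul_div_assoc', le_div_iff₀ (hS τ)]
        exact h1
      · rw [le_div_iff₀ (hG0 τ), inv_mul_le_iff₀ hK, hG, div_le_iff₀ (hS τ), mul_assoc]
        exact h2
    have hpow : Tendsto (fun ρ : ℝ => ρ ^ Fintype.card X) (𝓝[>] 1) (𝓝 1) := by
      have : Tendsto (fun ρ : ℝ => ρ ^ Fintype.card X) (𝓝 1) (𝓝 (1 ^ Fintype.card X)) :=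
        (continuous_pow _).tendsto 1
      rw [one_pow] at this
      exact this.mono_left nhdsWithin_le_nhds
    have hpow' : Tendsto (fun ρ : ℝ => (ρ ^ Fintype.card X)⁻¹) (𝓝[>] 1) (𝓝 1) := by
      simpa using hpow.inv₀ one_ne_zero
    refine tendsto_order.2 ⟨fun c hc' => ?_, fun c hc' => ?_⟩
    · obtain ⟨ρ, h1, h2⟩ := ((hpow'.eventually_const_lt hc').and self_mem_nhdsWithin).exists
      filter_upwards [key ρ h2] with τ hτ using h1.trans_le hτ.2
    · obtain ⟨ρ, h1, h2⟩ := ((hpow.eventually_lt_const hc').and self_mem_nhdsWithin).exists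
      filter_upwards [key ρ h2] with τ hτ using hτ.1.trans_lt h1
  have := hratio.mul hL
  rw [one_mul] at this
  refine this.congr fun τ => div_mul_cancel₀ _ (hG0 τ).ne'


/-! ### Moment generating functions of centered noise -/

section Mgf

variable {Ω : Type*} [MeasurableSpace Ω] {μ : Measure Ω} [IsProbabilityMeasure μ] {Z : Ω → ℝ}

theorem exp_le_one_add_add_sq (x : ℝ) : Real.exp x ≤ 1 + x + x ^ 2 * Real.exp |x| := by
  have h := Complex.norm_exp_sub_sum_le_norm_mul_exp (x : ℂ) 2
  have h' : |Real.exp x - (1 + x)| ≤ |x| ^ 2 * Real.exp |x| := by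
    have e : Complex.exp x - ∑ m ∈ Finset.range 2, (x : ℂ) ^ m / (m.factorial : ℂ)
        = ((Real.exp x - (1 + x) : ℝ) : ℂ) := by
      simp [Finset.sum_range_succ]
    rw [e, Complex.norm_real, Complex.norm_real] at h
    exact h
  rw [sq_abs] at h'
  have := (abs_le.1 h').2
  linarith

theorem one_le_mgf_of_centered (hint : Integrable Z μ) (hmean : ∫ ω, Z ω ∂μ = 0) {t : ℝ}
    (ht : Integrable (fun ω => Real.exp (t * Z ω)) μ) : 1 ≤ mgf Z μ t := by
  have h : ∫ ω, (t * Z ω + 1) ∂μ ≤ ∫ ω, Real.exp (t * Z ω) ∂μ :=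
    integral_mono ((hint.const_mul t).add (integrable_const 1)) ht
      fun ω => Real.add_one_le_exp _
  rw [integral_add (hint.const_mul t) (integrable_const 1), integral_const_mul, hmean] at h
  simpa [mgf] using h

/-- Equality case of exp y ≥ 1 + y, which is strict for y ≠ 0. -/
theorem ae_eq_zero_of_mgf_le_one (hint : Integrable Z μ) (hmean : ∫ ω, Z ω ∂μ = 0) {t : ℝ}
    (ht0 : t ≠ 0) (ht : Integrable (fun ω => Real.exp (t * Z ω)) μ) (hle : mgf Z μ t ≤ 1) :
    Z =ᵐ[μ] 0 := by
  have hi : Integrable (fun ω => t * Z ω + 1) μ := (hint.const_mul t).add (integrable_const 1)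
  have h0 : ∫ ω, (Real.exp (t * Z ω) - (t * Z ω + 1)) ∂μ = 0 := by
    refine le_antisymm ?_ (integral_nonneg fun ω => sub_nonneg.2 (Real.add_one_le_exp _))
    rw [integral_sub ht hi, integral_add (hint.const_mul t) (integrable_const 1),
      integral_const_mul, hmean]
    simpa [mgf] using hle
  rw [integral_eq_zero_iff_of_nonneg (fun ω => sub_nonneg.2 (Real.add_one_le_exp _))
    (ht.sub hi)] at h0
  filter_upwards [h0] with ω hω
  by_contra hne
  have := Real.add_one_lt_exp (mul_ne_zero ht0 hne)
  simp only [Pi.zero_apply] at hω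
  linarith

/-- Centering removes the linear Taylor term. For |u| ≤ 1 the remainder Z² exp|uZ| is at most 2
exp(2|Z|), whose bound by exponential moments is independent of u. -/
theorem exists_mgf_le_one_add_sq (hint : Integrable Z μ) (hmean : ∫ ω, Z ω ∂μ = 0)
    (hexp : ∀ t, Integrable (fun ω => Real.exp (t * Z ω)) μ) :
    ∃ C : ℝ, 0 ≤ C ∧ ∀ u, |u| ≤ 1 → mgf Z μ u ≤ 1 + C * u ^ 2 := by
  have hE : Integrable (fun ω => 2 * (Real.exp (2 * Z ω) + Real.exp (-2 * Z ω))) μ :=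
    ((hexp 2).add (hexp (-2))).const_mul 2
  refine ⟨∫ ω, 2 * (Real.exp (2 * Z ω) + Real.exp (-2 * Z ω)) ∂μ,
    integral_nonneg fun ω => by positivity, fun u hu => ?_⟩
  have hpt : ∀ ω, Real.exp (u * Z ω)
      ≤ (1 + u * Z ω) + u ^ 2 * (2 * (Real.exp (2 * Z ω) + Real.exp (-2 * Z ω))) := by
    intro ω
    have h1 := exp_le_one_add_add_sq (u * Z ω)
    have h2 : Real.exp |u * Z ω| ≤ Real.exp |Z ω| := by
      rw [abs_mul]
      exact Real.exp_le_exp.2 (mul_le_of_le_one_left (abs_nonneg _) hu)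
    have h3 : Z ω ^ 2 ≤ 2 * Real.exp |Z ω| := by
      have := Real.quadratic_le_exp_of_nonneg (abs_nonneg (Z ω))
      rw [sq_abs] at this
      linarith [abs_nonneg (Z ω)]
    have h4 : Real.exp |Z ω| * Real.exp |Z ω| ≤ Real.exp (2 * Z ω) + Real.exp (-2 * Z ω) := by
      rw [← Real.exp_add]
      rcases abs_cases (Z ω) with ⟨h, _⟩ | ⟨h, _⟩ <;> rw [h]
      · rw [← two_mul]
        exact le_add_of_nonneg_right (Real.exp_pos _).le
      · rw [show -Z ω + -Z ω = -2 * Z ω by ring]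
        exact le_add_of_nonneg_left (Real.exp_pos _).le
    have h5 : Z ω ^ 2 * Real.exp |u * Z ω|
        ≤ 2 * (Real.exp (2 * Z ω) + Real.exp (-2 * Z ω)) := by
      calc Z ω ^ 2 * Real.exp |u * Z ω| ≤ (2 * Real.exp |Z ω|) * Real.exp |Z ω| :=
            mul_le_mul h3 h2 (Real.exp_pos _).le (by positivity)
        _ ≤ _ := by rw [mul_assoc]; linarith
    have := mul_le_mul_of_nonneg_left h5 (sq_nonneg u)
    calc Real.exp (u * Z ω) ≤ _ := h1
      _ ≤ _ := by rw [mul_pow, mul_assoc]; linarith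
  have hi : Integrable (fun ω => 1 + u * Z ω) μ := (integrable_const 1).add (hint.const_mul u)
  have := integral_mono (hexp u) (hi.add (hE.const_mul (u ^ 2))) hpt
  simp only [Pi.add_apply] at this
  rw [integral_add hi (hE.const_mul _), integral_add (integrable_const 1) (hint.const_mul u),
    integral_const_mul, integral_const_mul, hmean] at this
  simpa [mgf, mul_comm] using this

/-- Jensen for x ↦ x^(θ/ε): beyond ε, log M grows at least linearly. -/
theorem mgf_rpow_le_mgf (hexp : ∀ t, Integrable (fun ω => Real.exp (t * Z ω)) μ)
    {ε θ : ℝ} (hε : 0 < ε) (hθ : ε ≤ θ) : mgf Z μ ε ^ (θ / ε) ≤ mgf Z μ θ := by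
  have hp : 1 ≤ θ / ε := (one_le_div hε).2 hθ
  have hcomp : ∀ ω, Real.exp (ε * Z ω) ^ (θ / ε) = Real.exp (θ * Z ω) := fun ω => by
    rw [← Real.exp_mul]
    congr 1
    field_simp
  have := (convexOn_rpow hp).map_integral_le (μ := μ) (f := fun ω => Real.exp (ε * Z ω))
    (Real.continuous_rpow_const (by linarith)).continuousOn isClosed_Ici
    (ae_of_all _ fun ω => (Real.exp_pos _).le) (hexp ε)
    (by simpa only [Function.comp_def, hcomp] using hexp θ)
  simpa only [hcomp, mgf] using this

/-- The rate function of a centered nondegenerate random variable is positive at `s > 0` and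
is `o(s)` as `s → 0+`. -/
theorem eventually_rate_pos_and_le (hint : Integrable Z μ) (hmean : ∫ ω, Z ω ∂μ = 0)
    (hexp : ∀ t, Integrable (fun ω => Real.exp (t * Z ω)) μ) (hne : ¬ Z =ᵐ[μ] 0)
    {ε : ℝ} (hε : 0 < ε) :
    ∀ᶠ s in 𝓝[>] (0 : ℝ), ∀ θ : ℝ,
      (∀ θ' : ℝ, θ' * s - Real.log (mgf Z μ θ') ≤ θ * s - Real.log (mgf Z μ θ)) →
      0 < θ * s - Real.log (mgf Z μ θ) ∧ θ * s - Real.log (mgf Z μ θ) ≤ ε * s := by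
  have hM1 : ∀ t, 1 ≤ mgf Z μ t := fun t => one_le_mgf_of_centered hint hmean (hexp t)
  have hMε : 1 < mgf Z μ ε := by
    by_contra h
    exact hne (ae_eq_zero_of_mgf_le_one hint hmean hε.ne' (hexp ε) (not_lt.1 h))
  have hlog : 0 < Real.log (mgf Z μ ε) / ε := div_pos (Real.log_pos hMε) hε
  obtain ⟨C, hC0, hC⟩ := exists_mgf_le_one_add_sq hint hmean hexp
  filter_upwards [self_mem_nhdsWithin, nhdsWithin_le_nhds (Iio_mem_nhds hlog),
    nhdsWithin_le_nhds (Iio_mem_nhds one_pos)]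
    with s (hs : 0 < s) (hs1 : s < Real.log (mgf Z μ ε) / ε) (hs2 : s < 1) θ hθ
  constructor
  -- The trial point u = s/(C+1) already gives a positive value: log M(u) ≤ Cu² < (C+1)u² = us.
  · have hu0 : 0 < s / (C + 1) := by positivity
    have hu : |s / (C + 1)| ≤ 1 := by
      rw [abs_of_pos hu0, div_le_one (by linarith)]
      linarith
    refine lt_of_lt_of_le ?_ (hθ (s / (C + 1)))
    have h1 : Real.log (mgf Z μ (s / (C + 1))) ≤ C * (s / (C + 1)) ^ 2 := by
      have := Real.log_le_sub_one_of_pos (lt_of_lt_of_le one_pos (hM1 (s / (C + 1))))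
      linarith [hC _ hu]
    have h2 : C * (s / (C + 1)) ^ 2 < s / (C + 1) * s := by
      have : s / (C + 1) * s = (C + 1) * (s / (C + 1)) ^ 2 := by field_simp
      rw [this]
      nlinarith [pow_pos hu0 2]
    linarith
  -- For θ ≤ ε it suffices that log M ≥ 0. For θ > ε the linear growth of log M exceeds θs, because
  -- s < log M(ε)/ε, and the value is at most 0.
  · rcases le_or_gt θ ε with h | h
    · have := Real.log_nonneg (hM1 θ)
      nlinarith
    · have h1 : θ / ε * Real.log (mgf Z μ ε) ≤ Real.log (mgf Z μ θ) := by
        rw [← Real.log_rpow (by linarith)]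
        exact Real.log_le_log (Real.rpow_pos_of_pos (by linarith) _)
          (mgf_rpow_le_mgf hexp hε h.le)
      have h2 : θ * s ≤ θ / ε * Real.log (mgf Z μ ε) := by
        rw [div_mul_eq_mul_div, mul_div_assoc]
        exact mul_le_mul_of_nonneg_left hs1.le (by linarith)
      nlinarith

/-- The exponential moments of the rescaled sample mean tend to one when the number of samples
grows faster than `τ⁻²`. -/
theorem tendsto_mgf_pow_one (hint : Integrable Z μ) (hmean : ∫ ω, Z ω ∂μ = 0)
    (hexp : ∀ t, Integrable (fun ω => Real.exp (t * Z ω)) μ) {N : ℝ → ℕ}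
    (hN : Tendsto (fun τ => (N τ : ℝ) * τ ^ 2) (𝓝[>] 0) atTop) {s : ℝ} (hs : |s| = 1) :
    Tendsto (fun τ => mgf Z μ (s / (N τ * τ)) ^ N τ) (𝓝[>] 0) (𝓝 1) := by
  obtain ⟨C, hC0, hC⟩ := exists_mgf_le_one_add_sq hint hmean hexp
  have hup : Tendsto (fun τ => Real.exp (C * ((N τ : ℝ) * τ ^ 2)⁻¹)) (𝓝[>] 0) (𝓝 1) := by
    have := (hN.inv_tendsto_atTop).const_mul C
    rw [mul_zero] at this
    simpa [Function.comp_def] using (Real.continuous_exp.tendsto 0).comp this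
  refine tendsto_of_tendsto_of_tendsto_of_le_of_le' tendsto_const_nhds hup
    (Eventually.of_forall fun τ => one_le_pow₀ (one_le_mgf_of_centered hint hmean (hexp _))) ?_
  filter_upwards [hN.eventually_ge_atTop 1, self_mem_nhdsWithin,
    nhdsWithin_le_nhds (Iio_mem_nhds one_pos)] with τ h1 (h0 : 0 < τ) (h2 : τ < 1)
  have hNpos : (0 : ℝ) < N τ := by
    by_contra h
    nlinarith [sq_nonneg τ]
  -- The quadratic bound on M applies because Nτ ≥ Nτ² ≥ 1.
  have hu : |s / (N τ * τ)| ≤ 1 := by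
    rw [abs_div, hs, abs_of_pos (mul_pos hNpos h0), div_le_one (mul_pos hNpos h0)]
    nlinarith [mul_pos hNpos h0]
  have hs2 : s ^ 2 = 1 := by rw [← sq_abs, hs, one_pow]
  calc mgf Z μ (s / (N τ * τ)) ^ N τ ≤ (1 + C * (s / (N τ * τ)) ^ 2) ^ N τ :=
        pow_le_pow_left₀ mgf_nonneg (hC _ hu) _
    _ ≤ Real.exp (C * (s / (N τ * τ)) ^ 2) ^ N τ := by
        refine pow_le_pow_left₀ (by positivity) ?_ _
        linarith [Real.add_one_le_exp (C * (s / (N τ * τ)) ^ 2)]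
    _ = Real.exp (C * ((N τ : ℝ) * τ ^ 2)⁻¹) := by
        rw [← Real.exp_nat_mul, div_pow, hs2]
        congr 1
        field_simp

/-- Degenerate noise is set apart: for ℓ = 0 the sample bound is vacuous, and the rate estimate
needs nondegeneracy. -/
theorem tendsto_mgf_pow_one_of_ae_eq_zero (hZ : Z =ᵐ[μ] 0) (t : ℝ → ℝ) (N : ℝ → ℕ) :
    Tendsto (fun τ => mgf Z μ (t τ) ^ N τ) (𝓝[>] 0) (𝓝 1) := by
  have : ∀ u, mgf Z μ u = 1 := fun u => by rw [mgf_congr hZ]; simp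
  simp [this]

end Mgf

/-! ### Logistic acceptance under random perturbation -/

section Logistic

variable {Ω : Type*} [MeasurableSpace Ω] {μ : Measure Ω} [IsProbabilityMeasure μ]

theorem integrable_logistic {V : Ω → ℝ} (hV : AEMeasurable V μ) :
    Integrable (fun ω => (1 + Real.exp (V ω))⁻¹) μ := by
  refine Integrable.of_bound (C := 1)
    ((hV.exp.const_add 1).inv).aestronglyMeasurable (ae_of_all _ fun ω => ?_)
  rw [Real.norm_of_nonneg (by positivity)]
  exact inv_le_one_of_one_le₀ (by linarith [Real.exp_pos (V ω)])

theorem integral_logistic_pos {V : Ω → ℝ} (hV : AEMeasurable V μ) :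
    0 < ∫ ω, (1 + Real.exp (V ω))⁻¹ ∂μ := by
  rw [integral_pos_iff_support_of_nonneg (fun ω => by positivity) (integrable_logistic hV)]
  have : Function.support (fun ω => (1 + Real.exp (V ω))⁻¹) = Set.univ := by
    ext ω
    simp only [Function.mem_support, Set.mem_univ, iff_true]
    positivity
  rw [this]
  simp

theorem integral_logistic_le_one {V : Ω → ℝ} (hV : AEMeasurable V μ) :
    ∫ ω, (1 + Real.exp (V ω))⁻¹ ∂μ ≤ 1 := by
  have := integral_mono (μ := μ) (integrable_logistic hV) (integrable_const 1)
    fun ω => inv_le_one_of_one_le₀ (by linarith [Real.exp_pos (V ω)])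
  simpa using this

/-- This symmetry turns the Jensen lower bound for -V into an upper bound for V. -/
theorem integral_logistic_neg {V : Ω → ℝ} (hV : AEMeasurable V μ) :
    ∫ ω, (1 + Real.exp (-V ω))⁻¹ ∂μ = 1 - ∫ ω, (1 + Real.exp (V ω))⁻¹ ∂μ := by
  have h : ∀ ω, (1 + Real.exp (-V ω))⁻¹ = 1 - (1 + Real.exp (V ω))⁻¹ := fun ω => by
    rw [Real.exp_neg]
    have := Real.exp_pos (V ω)
    field_simp
    ring
  simp_rw [h]
  rw [integral_sub (integrable_const 1) (integrable_logistic hV)]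
  simp

/-- Jensen's inequality for `w ↦ (1 + d w)⁻¹`. -/
theorem inv_one_add_mul_integral_le {V : Ω → ℝ} (hV : AEMeasurable V μ)
    (hi : Integrable (fun ω => Real.exp (V ω)) μ) (x : ℝ) :
    (1 + Real.exp x * ∫ ω, Real.exp (V ω) ∂μ)⁻¹
      ≤ ∫ ω, (1 + Real.exp (x + V ω))⁻¹ ∂μ := by
  set m := 1 + Real.exp x * ∫ ω, Real.exp (V ω) ∂μ with hm
  have hm0 : 0 < m := by
    have : 0 ≤ ∫ ω, Real.exp (V ω) ∂μ := integral_nonneg fun ω => (Real.exp_pos _).le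
    positivity
  -- The tangent to y ↦ 1/y at the mean m lies below the graph; the gap is y(1/y - 1/m)².
  have hpt : ∀ ω, 2 * m⁻¹ - (m⁻¹) ^ 2 * (1 + Real.exp x * Real.exp (V ω))
      ≤ (1 + Real.exp (x + V ω))⁻¹ := fun ω => by
    rw [Real.exp_add]
    set y := 1 + Real.exp x * Real.exp (V ω)
    have hy : 0 < y := by positivity
    have : y⁻¹ - (2 * m⁻¹ - (m⁻¹) ^ 2 * y) = y * (y⁻¹ - m⁻¹) ^ 2 := by
      field_simp
      ring
    nlinarith [mul_nonneg hy.le (sq_nonneg (y⁻¹ - m⁻¹))]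
  have hi2 : Integrable (fun ω => 1 + Real.exp x * Real.exp (V ω)) μ :=
    (integrable_const 1).add (hi.const_mul _)
  have := integral_mono ((integrable_const (2 * m⁻¹)).sub (hi2.const_mul _))
    (integrable_logistic (hV.const_add x)) hpt
  simp only [Pi.sub_apply] at this
  rw [integral_sub (integrable_const _) (hi2.const_mul _), integral_const_mul _ (fun ω => 1 + _),
    integral_add (integrable_const 1) (hi.const_mul _), integral_const_mul] at this
  simp only [integral_const, probReal_univ, smul_eq_mul, one_mul] at this
  rw [integral_const_mul, ← hm] at this
  refine le_trans (le_of_eq ?_) this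
  field_simp
  ring

/-- The resistance of a logistic acceptance probability that is perturbed by a random variable
whose exponential moments at the scale of the temperature tend to one. -/
theorem tendsto_integral_logistic_div_exp {V : ℝ → Ω → ℝ} (hV : ∀ τ, AEMeasurable (V τ) μ)
    (hi : ∀ τ, Integrable (fun ω => Real.exp (V τ ω / τ)) μ)
    (hi' : ∀ τ, Integrable (fun ω => Real.exp (-(V τ ω / τ))) μ)
    (hlim : Tendsto (fun τ => ∫ ω, Real.exp (V τ ω / τ) ∂μ) (𝓝[>] 0) (𝓝 1))
    (hlim' : Tendsto (fun τ => ∫ ω, Real.exp (-(V τ ω / τ)) ∂μ) (𝓝[>] 0) (𝓝 1)) (Δ : ℝ) :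
    Tendsto (fun τ => (∫ ω, (1 + Real.exp ((Δ + V τ ω) / τ))⁻¹ ∂μ)
        / Real.exp (-(max 0 Δ) / τ)) (𝓝[>] 0) (𝓝 (if Δ = 0 then 1 / 2 else 1)) := by
  have hV' : ∀ τ, AEMeasurable (fun ω => V τ ω / τ) μ := fun τ => (hV τ).div_const τ
  have hlow : ∀ τ, (1 + Real.exp (Δ / τ) * ∫ ω, Real.exp (V τ ω / τ) ∂μ)⁻¹
      ≤ ∫ ω, (1 + Real.exp ((Δ + V τ ω) / τ))⁻¹ ∂μ := fun τ => by
    simp_rw [add_div]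
    exact inv_one_add_mul_integral_le (hV' τ) (hi τ) _
  have hinv : Tendsto (fun τ : ℝ => τ⁻¹) (𝓝[>] 0) atTop := tendsto_inv_nhdsGT_zero
  -- Jensen gives the lower bound in every case. The upper bound is 1 for Δ < 0, Jensen for -V when
  -- Δ = 0, and (1 + exp x)⁻¹ ≤ exp(-x) for Δ > 0.
  rcases lt_trichotomy Δ 0 with h | rfl | h
  · have hd : Tendsto (fun τ => Real.exp (Δ / τ)) (𝓝[>] 0) (𝓝 0) := by
      simp_rw [div_eq_mul_inv]
      exact Real.tendsto_exp_atBot.comp (hinv.const_mul_atTop_of_neg h)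
    simp only [max_eq_left h.le, neg_zero, zero_div, Real.exp_zero, div_one, h.ne, if_false]
    have h1 : Tendsto (fun τ => (1 + Real.exp (Δ / τ) * ∫ ω, Real.exp (V τ ω / τ) ∂μ)⁻¹)
        (𝓝[>] 0) (𝓝 1) := by
      simpa using ((hd.mul hlim).const_add 1).inv₀ (by norm_num)
    exact tendsto_of_tendsto_of_tendsto_of_le_of_le h1 tendsto_const_nhds hlow
      fun τ => integral_logistic_le_one (((hV τ).const_add Δ).div_const τ)
  · simp only [max_self, neg_zero, zero_div, Real.exp_zero, div_one, if_true, zero_add]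
    have h1 : Tendsto (fun τ => (1 + ∫ ω, Real.exp (V τ ω / τ) ∂μ)⁻¹) (𝓝[>] 0) (𝓝 (1 / 2)) := by
      convert (hlim.const_add 1).inv₀ (by norm_num) using 2
      norm_num
    have h2 : Tendsto (fun τ => 1 - (1 + ∫ ω, Real.exp (-(V τ ω / τ)) ∂μ)⁻¹)
        (𝓝[>] 0) (𝓝 (1 / 2)) := by
      convert ((hlim'.const_add 1).inv₀ (by norm_num)).const_sub 1 using 2
      norm_num
    refine tendsto_of_tendsto_of_tendsto_of_le_of_le h1 h2 (fun τ => ?_) fun τ => ?_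
    · simpa using hlow τ
    · have := inv_one_add_mul_integral_le (hV' τ).neg (hi' τ) 0
      simp only [Real.exp_zero, one_mul, zero_add, Pi.neg_apply] at this
      rw [integral_logistic_neg (hV' τ)] at this
      change _ ≤ _
      linarith
  · have hd : Tendsto (fun τ => Real.exp (-Δ / τ)) (𝓝[>] 0) (𝓝 0) := by
      simp_rw [div_eq_mul_inv]
      exact Real.tendsto_exp_atBot.comp (hinv.const_mul_atTop_of_neg (neg_lt_zero.2 h))
    simp only [max_eq_right h.le, h.ne', if_false]
    have h1 : Tendsto (fun τ => (Real.exp (-Δ / τ) + ∫ ω, Real.exp (V τ ω / τ) ∂μ)⁻¹)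
        (𝓝[>] 0) (𝓝 1) := by
      simpa using (hd.add hlim).inv₀ (by norm_num)
    refine tendsto_of_tendsto_of_tendsto_of_le_of_le h1 hlim' (fun τ => ?_) fun τ => ?_
    · rw [le_div_iff₀ (Real.exp_pos _)]
      refine le_trans (le_of_eq ?_) (hlow τ)
      have hm : 0 ≤ ∫ ω, Real.exp (V τ ω / τ) ∂μ := integral_nonneg fun ω => (Real.exp_pos _).le
      rw [neg_div, Real.exp_neg]
      have := Real.exp_pos (Δ / τ)
      field_simp
    · change _ / _ ≤ ∫ ω, Real.exp (-(V τ ω / τ)) ∂μ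
      rw [div_le_iff₀ (Real.exp_pos _), ← integral_mul_const]
      refine integral_mono (integrable_logistic (((hV τ).const_add Δ).div_const τ))
        ((hi' τ).mul_const _) fun ω => ?_
      change _ ≤ Real.exp (-(V τ ω / τ)) * Real.exp (-Δ / τ)
      rw [← Real.exp_add, show -(V τ ω / τ) + -Δ / τ = -((Δ + V τ ω) / τ) by ring, Real.exp_neg]
      exact inv_anti₀ (Real.exp_pos _) (by linarith)

end Logistic


/-! ### Transitions of the learning chain -/

section Chain

variable {D F : Type*} [Fintype D] [DecidableEq D] [Fintype F] [DecidableEq F]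
  {accept : D → (D → F) → F → ℝ}

/-- A genuine deviation determines its player and action, so a single term of the double sum in
`chain` contributes to it. -/
theorem update_eq_update_iff {a : D → F} {i j : D} {c d : F} (hc : c ≠ a i) :
    Function.update a i c = Function.update a j d ↔ j = i ∧ d = c := by
  constructor
  · intro h
    have hi := congrFun h i
    rw [Function.update_self] at hi
    by_cases hij : i = j
    · subst hij
      rw [Function.update_self] at hi
      exact ⟨rfl, hi.symm⟩
    · rw [Function.update_of_ne hij] at hi
      exact absurd hi hc
  · rintro ⟨rfl, rfl⟩
    rfl

theorem update_ne_self {a : D → F} {i : D} {c : F} (hc : c ≠ a i) :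
    Function.update a i c ≠ a := fun h => hc (by
  have := congrFun h i
  rwa [Function.update_self] at this)

theorem chain_apply_update (a : D → F) (i : D) (c : F) (hc : c ≠ a i) :
    chain accept a (Function.update a i c)
      = 1 / ((Fintype.card D : ℝ) * (Fintype.card F : ℝ)) * accept i a c := by
  simp only [chain, update_eq_update_iff hc, update_ne_self hc, if_false, mul_zero, add_zero]
  rw [Finset.sum_eq_single i, Finset.sum_eq_single c]
  · simp
  · intro d _ hd
    simp [hd]
  · simp
  · intro j _ hj
    simp [hj]
  · simp

theorem chain_apply_eq_zero {a b : D → F} (hab : b ≠ a)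
    (h : ∀ i c, b ≠ Function.update a i c) : chain accept a b = 0 := by
  simp [chain, hab, h]

theorem sum_chain [Nonempty D] [Nonempty F] (a : D → F) : ∑ b, chain accept a b = 1 := by
  simp only [chain]
  rw [Finset.sum_comm]
  have : ∀ i : D, ∑ b : D → F, ∑ c : F, 1 / ((Fintype.card D : ℝ) * (Fintype.card F : ℝ)) *
      (accept i a c * (if b = Function.update a i c then 1 else 0)
        + (1 - accept i a c) * (if b = a then 1 else 0)) = 1 / (Fintype.card D : ℝ) := by
    intro i
    rw [Finset.sum_comm]
    have h1 : (Fintype.card F : ℝ) ≠ 0 := by simp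
    have h2 : (Fintype.card D : ℝ) ≠ 0 := by simp
    simp only [← Finset.mul_sum, Finset.sum_add_distrib, Finset.sum_ite_eq', Finset.mem_univ,
      if_true, mul_one, add_sub_cancel, Finset.sum_const, Finset.card_univ, nsmul_eq_mul]
    field_simp
  rw [Finset.sum_congr rfl fun i _ => this i]
  simp

theorem chain_nonneg (h0 : ∀ i a c, 0 ≤ accept i a c) (h1 : ∀ i a c, accept i a c ≤ 1)
    (a b : D → F) : 0 ≤ chain accept a b := by
  refine Finset.sum_nonneg fun i _ => Finset.sum_nonneg fun c _ => ?_
  have h2 := h0 i a c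
  have h3 := sub_nonneg.2 (h1 i a c)
  positivity

/-- A nonempty set closed under unilateral changes contains every profile: change the coordinates
one at a time. -/
theorem exists_update_not_mem {S : Finset (D → F)} (hne : S.Nonempty) (hS : S ≠ Finset.univ) :
    ∃ a ∈ S, ∃ i c, Function.update a i c ∉ S := by
  by_contra! h
  obtain ⟨a, ha⟩ := hne
  refine hS (Finset.eq_univ_of_forall fun b => ?_)
  have : ∀ s : Finset D, s.piecewise b a ∈ S := by
    intro s
    induction s using Finset.induction_on with
    | empty => simpa using ha
    | insert j s _ ih =>
      rw [Finset.piecewise_insert]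
      exact h _ ih j (b j)
  simpa using this Finset.univ

theorem crossesCuts_chain [Nonempty D] [Nonempty F] (h0 : ∀ i a c, 0 < accept i a c) :
    CrossesCuts (chain accept) := by
  intro S hne hS
  obtain ⟨a, ha, i, c, hb⟩ := exists_update_not_mem hne hS
  have hc : c ≠ a i := by
    rintro rfl
    rw [Function.update_eq_self] at hb
    exact hb ha
  refine ⟨a, ha, _, hb, ?_⟩
  rw [chain_apply_update a i c hc]
  have := h0 i a c
  have h1 : (0 : ℝ) < Fintype.card F := by simp [Fintype.card_pos]
  have h2 : (0 : ℝ) < Fintype.card D := by simp [Fintype.card_pos]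
  positivity

end Chain

/-! ### The potential game and its estimation noise -/

section Game

variable {D F Ω : Type*} [Fintype D] [DecidableEq D] [Fintype F] [DecidableEq F]

theorem sumRate_eq_sum_channels (r : D → F → Finset D → ℝ) (a : D → F) :
    sumRate r a = ∑ c, ∑ j ∈ users a c, r j c (users a c) := by
  rw [sumRate, ← Finset.sum_fiberwise Finset.univ a]
  refine Finset.sum_congr rfl fun c _ => Finset.sum_congr rfl fun j hj => ?_
  rw [(Finset.mem_filter.1 hj).2]

/-- The sum rate minus the marginal contribution of a player is the sum rate that the other
players have in its absence. -/
theorem sumRate_sub_marginal (r : D → F → Finset D → ℝ) (i : D) (a : D → F) :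
    sumRate r a - marginal r i a
      = ∑ c, ∑ j ∈ (users a c).erase i, r j c ((users a c).erase i) := by
  rw [sumRate_eq_sum_channels, marginal,
    ← Finset.add_sum_erase Finset.univ _ (Finset.mem_univ (a i)),
    ← Finset.add_sum_erase Finset.univ (fun c => ∑ j ∈ (users a c).erase i, _)
      (Finset.mem_univ (a i))]
  -- Only the channel of `i` is affected by removing `i`.
  have : ∀ c ∈ Finset.univ.erase (a i), (users a c).erase i = users a c := fun c hc => by
    refine Finset.erase_eq_of_notMem fun hi => ?_
    exact (Finset.mem_erase.1 hc).1 (Finset.mem_filter.1 hi).2.symm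
  have hsum : ∑ c ∈ Finset.univ.erase (a i),
      ∑ j ∈ (users a c).erase i, r j c ((users a c).erase i)
        = ∑ c ∈ Finset.univ.erase (a i), ∑ j ∈ users a c, r j c (users a c) :=
    Finset.sum_congr rfl fun c hc => by rw [this c hc]
  rw [hsum]
  ring

theorem users_update_erase (a : D → F) (i : D) (c d : F) :
    (users (Function.update a i c) d).erase i = (users a d).erase i := by
  ext j
  simp only [users, Finset.mem_erase, Finset.mem_filter, Finset.mem_univ, true_and]
  refine and_congr_right fun hj => ?_
  rw [Function.update_of_ne hj]

/-- The sum rate in the absence of `i` does not see the action of `i`, so it cancels, for every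
table of rates. -/
theorem marginal_sub_marginal (r : D → F → Finset D → ℝ) (i : D) (a : D → F) (c : F) :
    marginal r i a - marginal r i (Function.update a i c)
      = sumRate r a - sumRate r (Function.update a i c) := by
  have h1 := sumRate_sub_marginal r i a
  have h2 := sumRate_sub_marginal r i (Function.update a i c)
  simp only [users_update_erase] at h2
  linarith

theorem measurable_marginal (i : D) (a : D → F) :
    Measurable fun r : D → F → Finset D → ℝ => marginal r i a := by
  unfold marginal
  fun_prop

variable [MeasurableSpace Ω] {μ : Measure Ω} {rate : ℕ → Ω → D → F → Finset D → ℝ}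

theorem integrable_marginal
    (h_int : ∀ (j : D) (c : F) (S : Finset D), Integrable (fun ω => rate 0 ω j c S) μ)
    (i : D) (a : D → F) : Integrable (fun ω => marginal (rate 0 ω) i a) μ :=
  (integrable_finsetSum _ fun _ _ => h_int _ _ _).sub
    (integrable_finsetSum _ fun _ _ => h_int _ _ _)

/-- The game with the expected utilities is an exact potential game. -/
theorem meanUtility_sub_meanUtility
    (h_int : ∀ (j : D) (c : F) (S : Finset D), Integrable (fun ω => rate 0 ω j c S) μ)
    (i : D) (a : D → F) (c : F) :
    meanUtility μ rate i a - meanUtility μ rate i (Function.update a i c)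
      = potential μ rate a - potential μ rate (Function.update a i c) := by
  have hs : ∀ a, Integrable (fun ω => sumRate (rate 0 ω) a) μ := fun a =>
    integrable_finsetSum _ fun _ _ => h_int _ _ _
  rw [meanUtility, meanUtility, potential, potential,
    ← integral_sub (integrable_marginal h_int i a) (integrable_marginal h_int i _),
    ← integral_sub (hs _) (hs _)]
  simp_rw [marginal_sub_marginal]

variable [IsProbabilityMeasure μ]

theorem integrable_noise
    (h_int : ∀ (j : D) (c : F) (S : Finset D), Integrable (fun ω => rate 0 ω j c S) μ)
    (i : D) (a : D → F) (c : F) : Integrable (noise μ rate 0 i a c) μ :=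
  ((integrable_marginal h_int i a).sub (integrable_const _)).sub
    ((integrable_marginal h_int i _).sub (integrable_const _))

theorem integral_noise
    (h_int : ∀ (j : D) (c : F) (S : Finset D), Integrable (fun ω => rate 0 ω j c S) μ)
    (i : D) (a : D → F) (c : F) : ∫ ω, noise μ rate 0 i a c ω ∂μ = 0 := by
  have h : ∀ b, Integrable (fun ω => marginal (rate 0 ω) i b - meanUtility μ rate i b) μ :=
    fun b => (integrable_marginal h_int i b).sub (integrable_const _)
  have h0 : ∀ b, ∫ ω, (marginal (rate 0 ω) i b - meanUtility μ rate i b) ∂μ = 0 := fun b => by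
    rw [integral_sub (integrable_marginal h_int i b) (integrable_const _)]
    simp [meanUtility]
  unfold noise
  rw [integral_sub (h a) (h _), h0, h0, sub_zero]

theorem measurable_noise (h_meas : ∀ k, Measurable (rate k)) (k : ℕ) (i : D) (a : D → F) (c : F) :
    Measurable (noise μ rate k i a c) :=
  (((measurable_marginal i a).comp (h_meas k)).sub_const _).sub
    (((measurable_marginal i _).comp (h_meas k)).sub_const _)

theorem iIndepFun_noise (h_indep : iIndepFun rate μ) (i : D) (a : D → F) (c : F) :
    iIndepFun (fun k => noise μ rate k i a c) μ :=
  h_indep.comp (fun _ r => (marginal r i a - meanUtility μ rate i a)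
      - (marginal r i (Function.update a i c) - meanUtility μ rate i (Function.update a i c)))
    fun _ => ((measurable_marginal i a).sub_const _).sub ((measurable_marginal i _).sub_const _)

theorem identDistrib_noise (h_ident : ∀ k, IdentDistrib (rate k) (rate 0) μ μ)
    (k : ℕ) (i : D) (a : D → F) (c : F) :
    IdentDistrib (noise μ rate k i a c) (noise μ rate 0 i a c) μ μ :=
  (h_ident k).comp (u := fun r => (marginal r i a - meanUtility μ rate i a)
      - (marginal r i (Function.update a i c) - meanUtility μ rate i (Function.update a i c)))
    (((measurable_marginal i a).sub_const _).sub ((measurable_marginal i _).sub_const _))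

/-- Positivity of `N` matters: for N = 0 the estimates vanish and the means would not be recovered.
-/
theorem sampleUtility_sub_sampleUtility {N : ℕ} (hN : 0 < N) (i : D) (a : D → F) (c : F) (ω : Ω) :
    sampleUtility rate N i a ω - sampleUtility rate N i (Function.update a i c) ω
      = meanUtility μ rate i a - meanUtility μ rate i (Function.update a i c)
        + (1 / (N : ℝ)) * (∑ k ∈ Finset.range N, noise μ rate k i a c) ω := by
  have hN' : (N : ℝ) ≠ 0 := by positivity
  simp only [sampleUtility, noise, Finset.sum_apply, Finset.sum_sub_distrib, Finset.sum_const,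
    Finset.card_range, nsmul_eq_mul]
  field_simp
  ring

theorem noisyAccept_pos (h_meas : ∀ k, Measurable (rate k)) (N : ℕ) (τ : ℝ)
    (i : D) (a : D → F) (c : F) : 0 < noisyAccept μ rate N τ i a c := by
  have hm := fun k i a => (measurable_marginal i a).comp (h_meas k)
  refine integral_logistic_pos (Measurable.aemeasurable ?_)
  exact ((((Finset.measurable_fun_sum _ fun k _ => hm k i a).const_mul _).sub
    ((Finset.measurable_fun_sum _ fun k _ => hm k i _).const_mul _)).div_const _)

theorem noisyAccept_le_one (h_meas : ∀ k, Measurable (rate k)) (N : ℕ) (τ : ℝ)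
    (i : D) (a : D → F) (c : F) : noisyAccept μ rate N τ i a c ≤ 1 := by
  have hm := fun k i a => (measurable_marginal i a).comp (h_meas k)
  refine integral_logistic_le_one (Measurable.aemeasurable ?_)
  exact ((((Finset.measurable_fun_sum _ fun k _ => hm k i a).const_mul _).sub
    ((Finset.measurable_fun_sum _ fun k _ => hm k i _).const_mul _)).div_const _)

/-- By the i.i.d. assumption the exponential moment of the averaged noise at ±1/τ is the power of
`mgf` in `hlim`; the signs s = ±1 feed the two limits that the logistic estimate requires. -/
theorem tendsto_noisyAccept_div_exp (h_meas : ∀ k, Measurable (rate k))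
    (h_indep : iIndepFun rate μ) (h_ident : ∀ k, IdentDistrib (rate k) (rate 0) μ μ)
    {N : ℝ → ℕ} (hN : ∀ τ, 0 < τ → 0 < N τ) {i : D} {a : D → F} {c : F}
    (hexp : ∀ t, Integrable (fun ω => Real.exp (t * noise μ rate 0 i a c ω)) μ)
    (hlim : ∀ s : ℝ, |s| = 1 →
      Tendsto (fun τ => mgf (noise μ rate 0 i a c) μ (s / (N τ * τ)) ^ N τ) (𝓝[>] 0) (𝓝 1)) :
    Tendsto (fun τ => noisyAccept μ rate (N τ) τ i a c
        / Real.exp (-(max 0 (meanUtility μ rate i a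
          - meanUtility μ rate i (Function.update a i c))) / τ)) (𝓝[>] 0)
      (𝓝 (if meanUtility μ rate i a - meanUtility μ rate i (Function.update a i c) = 0
        then 1 / 2 else 1)) := by
  have hmeas : ∀ k, Measurable (noise μ rate k i a c) := fun k => measurable_noise h_meas k i a c
  have hind := iIndepFun_noise h_indep i a c (μ := μ)
  have hid := fun k => identDistrib_noise h_ident k i a c (μ := μ)
  set V : ℝ → Ω → ℝ := fun τ ω =>
    (1 / (N τ : ℝ)) * (∑ k ∈ Finset.range (N τ), noise μ rate k i a c) ω with hVdef
  have hV : ∀ τ, Measurable (V τ) := fun τ =>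
    by
    simp only [hVdef, Finset.sum_apply]
    exact (Finset.measurable_fun_sum _ fun k _ => hmeas k).const_mul _
  have hrew : ∀ (s τ : ℝ) ω, s * (V τ ω / τ)
      = s / (N τ * τ) * (∑ k ∈ Finset.range (N τ), noise μ rate k i a c) ω := fun s τ ω => by
    simp only [hVdef, div_eq_mul_inv, mul_inv]
    ring
  have hi : ∀ s τ : ℝ, Integrable (fun ω => Real.exp (s * (V τ ω / τ))) μ := fun s τ => by
    simp_rw [hrew]
    refine hind.integrable_exp_mul_sum hmeas fun k _ => ?_
    exact ((hid k).comp (u := fun x => Real.exp (s / (N τ * τ) * x))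
      (by fun_prop)).integrable_iff.2 (hexp _)
  have hl : ∀ s : ℝ, |s| = 1 →
      Tendsto (fun τ => ∫ ω, Real.exp (s * (V τ ω / τ)) ∂μ) (𝓝[>] 0) (𝓝 1) := fun s hs => by
    refine (hlim s hs).congr fun τ => ?_
    simp_rw [hrew]
    change _ = mgf _ _ _
    rw [hind.mgf_sum hmeas, Finset.prod_congr rfl fun k _ => mgf_congr_of_identDistrib _ _ (hid k) _]
    simp
  have key := tendsto_integral_logistic_div_exp (μ := μ) (V := V) (fun τ => (hV τ).aemeasurable)
    (fun τ => by simpa using hi 1 τ) (fun τ => by simpa using hi (-1) τ)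
    (by simpa using hl 1 (by simp)) (by simpa using hl (-1) (by simp))
    (meanUtility μ rate i a - meanUtility μ rate i (Function.update a i c))
  refine key.congr' ?_
  filter_upwards [self_mem_nhdsWithin] with τ (hτ : 0 < τ)
  simp only [noisyAccept, hVdef, sampleUtility_sub_sampleUtility (μ := μ) (hN τ hτ)]

theorem tendsto_exactAccept_div_exp (i : D) (a : D → F) (c : F) :
    Tendsto (fun τ => exactAccept μ rate τ i a c
        / Real.exp (-(max 0 (meanUtility μ rate i a
          - meanUtility μ rate i (Function.update a i c))) / τ)) (𝓝[>] 0)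
      (𝓝 (if meanUtility μ rate i a - meanUtility μ rate i (Function.update a i c) = 0
        then 1 / 2 else 1)) := by
  have key := tendsto_integral_logistic_div_exp (μ := μ) (V := fun _ _ => 0)
    (fun τ => aemeasurable_const) (by simp) (by simp) (by simp) (by simp)
    (meanUtility μ rate i a - meanUtility μ rate i (Function.update a i c))
  refine key.congr fun τ => ?_
  simp [exactAccept]

/-! ### Both sample-size conditions control the exponential moments -/

theorem tendsto_mgf_noise_of_bounded
    (h_meas : ∀ k, Measurable (rate k))
    (h_int : ∀ (j : D) (c : F) (S : Finset D), Integrable (fun ω => rate 0 ω j c S) μ)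
    {ξ : ℝ} (hξ0 : 0 < ξ) (hξ1 : ξ < 1) {N : ℝ → ℕ} {ℓ : ℝ}
    (h : BoundedNoiseCondition μ rate ξ N ℓ) {i : D} {a : D → F} {c : F} (hc : c ≠ a i) :
    (∀ t, Integrable (fun ω => Real.exp (t * noise μ rate 0 i a c ω)) μ) ∧
    ∀ s : ℝ, |s| = 1 →
      Tendsto (fun τ => mgf (noise μ rate 0 i a c) μ (s / (N τ * τ)) ^ N τ) (𝓝[>] 0) (𝓝 1) := by
  obtain ⟨α, hα⟩ := h.1 i a c hc
  have hint := integrable_noise h_int i a c (μ := μ)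
  have hmean := integral_noise h_int i a c (μ := μ)
  have hexp : ∀ t, Integrable (fun ω => Real.exp (t * noise μ rate 0 i a c ω)) μ := fun t =>
    integrable_exp_mul_of_mem_Icc (measurable_noise h_meas 0 i a c).aemeasurable hα
  refine ⟨hexp, fun s hs => ?_⟩
  by_cases hℓ : ℓ = 0
  · subst hℓ
    simp only [add_zero, Set.Icc_self, Set.mem_singleton_iff] at hα
    have hα0 : α = 0 := by
      have := integral_congr_ae (μ := μ) hα
      rw [hmean] at this
      simpa using this.symm
    subst hα0
    exact tendsto_mgf_pow_one_of_ae_eq_zero hα _ N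
  · refine tendsto_mgf_pow_one hint hmean hexp ?_ hs
    have hξ' : 0 < 1 - ξ := by linarith
    -- Dropping log(4/ξ) ≥ 0, the sample bound times τ² is this constant over τ, which diverges.
    have hK : 0 < ℓ ^ 2 / (1 - ξ) ^ 2 := by positivity
    refine tendsto_atTop_mono' _ ?_ (tendsto_inv_nhdsGT_zero.const_mul_atTop hK)
    filter_upwards [h.2, self_mem_nhdsWithin] with τ hτ (hτ0 : 0 < τ)
    have hlog : 0 ≤ Real.log (4 / ξ) := Real.log_nonneg (by rw [one_le_div hξ0]; linarith)
    calc ℓ ^ 2 / (1 - ξ) ^ 2 * τ⁻¹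
        = (0 + 2 / τ) * (ℓ ^ 2 / (2 * (1 - ξ) ^ 2 * τ ^ 2)) * τ ^ 2 := by field_simp; ring
      _ ≤ (Real.log (4 / ξ) + 2 / τ) * (ℓ ^ 2 / (2 * (1 - ξ) ^ 2 * τ ^ 2)) * τ ^ 2 := by gcongr
      _ ≤ N τ * τ ^ 2 := mul_le_mul_of_nonneg_right hτ (sq_nonneg τ)

theorem tendsto_mgf_noise_of_mgf
    (h_int : ∀ (j : D) (c : F) (S : Finset D), Integrable (fun ω => rate 0 ω j c S) μ)
    {ξ : ℝ} (hξ0 : 0 < ξ) (hξ1 : ξ < 1) {N : ℝ → ℕ}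
    (h : MGFNoiseCondition μ rate ξ N) {i : D} {a : D → F} {c : F} (hc : c ≠ a i) :
    (∀ t, Integrable (fun ω => Real.exp (t * noise μ rate 0 i a c ω)) μ) ∧
    ∀ s : ℝ, |s| = 1 →
      Tendsto (fun τ => mgf (noise μ rate 0 i a c) μ (s / (N τ * τ)) ^ N τ) (𝓝[>] 0) (𝓝 1) := by
  obtain ⟨hexp, hev⟩ := h i a c hc
  have hint := integrable_noise h_int i a c (μ := μ)
  have hmean := integral_noise h_int i a c (μ := μ)
  refine ⟨hexp, fun s hs => ?_⟩
  by_cases hZ : noise μ rate 0 i a c =ᵐ[μ] 0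
  · exact tendsto_mgf_pow_one_of_ae_eq_zero hZ _ N
  refine tendsto_mgf_pow_one hint hmean hexp (tendsto_atTop.2 fun B => ?_) hs
  have hξ' : 0 < 1 - ξ := by linarith
  have hscale : Tendsto (fun τ : ℝ => (1 - ξ) * τ) (𝓝[>] 0) (𝓝[>] 0) := by
    refine tendsto_nhdsWithin_iff.2 ⟨?_, ?_⟩
    · have : Tendsto (fun τ : ℝ => (1 - ξ) * τ) (𝓝 0) (𝓝 ((1 - ξ) * 0)) :=
        (continuous_const_mul _).tendsto 0
      rw [mul_zero] at this
      exact this.mono_left nhdsWithin_le_nhds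
    · filter_upwards [self_mem_nhdsWithin] with τ hτ using mul_pos hξ' hτ
  -- With this ε the rate I at (1-ξ)τ satisfies I(|B|+1) ≤ τ. Together with NI ≥ 2/τ this yields Nτ²
  -- ≥ 2(|B|+1) ≥ B.
  have hε : 0 < 1 / (|B| + 1) := by positivity
  filter_upwards [hev, self_mem_nhdsWithin,
    hscale.eventually (eventually_rate_pos_and_le hint hmean hexp hZ hε)]
    with τ ⟨θ, hmax, hNτ⟩ (hτ0 : 0 < τ) hrate
  have hM : 0 < mgf (noise μ rate 0 i a c) μ θ := mgf_pos (hexp θ)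
  obtain ⟨hI0, hI⟩ := hrate θ fun θ' => by
    simpa only [mul_assoc] using hmax θ'
  rw [Real.log_div (Real.exp_pos _).ne' hM.ne', Real.log_exp, mul_assoc] at hNτ
  set I := θ * ((1 - ξ) * τ) - Real.log (mgf (noise μ rate 0 i a c) μ θ)
  have hlog : 0 ≤ Real.log (4 / ξ) := Real.log_nonneg (by rw [one_le_div hξ0]; linarith)
  have hIτ : I * (|B| + 1) ≤ τ := by
    rw [div_mul_eq_mul_div, one_mul, le_div_iff₀ (by positivity)] at hI
    nlinarith
  rw [div_le_iff₀ hI0] at hNτ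
  have h1 : 2 ≤ N τ * I * τ := by
    have : 2 / τ ≤ N τ * I := by linarith
    rwa [div_le_iff₀ hτ0] at this
  have h2 : 2 * (|B| + 1) ≤ N τ * τ ^ 2 := by
    calc 2 * (|B| + 1) ≤ N τ * I * τ * (|B| + 1) := by gcongr
      _ = N τ * τ * (I * (|B| + 1)) := by ring
      _ ≤ N τ * τ * τ := by gcongr
      _ = N τ * τ ^ 2 := by ring
  linarith [le_abs_self B, abs_nonneg B]

/-! ### Resistances and asymptotic detailed balance -/

theorem hasResistance_chain [Nonempty D] [Nonempty F] {accept : ℝ → D → (D → F) → F → ℝ}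
    {i : D} {a : D → F} {c : F} (hc : c ≠ a i) {Δ : ℝ}
    (h : Tendsto (fun τ => accept τ i a c / Real.exp (-(max 0 Δ) / τ)) (𝓝[>] 0)
      (𝓝 (if Δ = 0 then 1 / 2 else 1))) :
    HasResistance (fun τ => chain (accept τ) a (Function.update a i c)) (max 0 Δ) := by
  have h1 : (0 : ℝ) < Fintype.card F := by simp [Fintype.card_pos]
  have h2 : (0 : ℝ) < Fintype.card D := by simp [Fintype.card_pos]
  refine ⟨le_max_left _ _, _, ?_, (h.const_mul
    (1 / ((Fintype.card D : ℝ) * (Fintype.card F : ℝ)))).congr fun τ => ?_⟩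
  · refine mul_pos (by positivity) ?_
    split_ifs <;> norm_num
  · simp only [chain_apply_update a i c hc, mul_div_assoc]

/-- The acceptance probabilities are asymptotically in detailed balance with the Boltzmann weights
of the potential. -/
theorem eventually_chain_almost_reversible {accept : ℝ → D → (D → F) → F → ℝ} {φ : (D → F) → ℝ}
    (hpos : ∀ τ i a c, 0 < accept τ i a c) (hle : ∀ τ i a c, accept τ i a c ≤ 1)
    (h : ∀ i a c, c ≠ a i →
      Tendsto (fun τ => accept τ i a c / Real.exp (-(max 0 (φ a - φ (Function.update a i c))) / τ))
        (𝓝[>] 0) (𝓝 (if φ a - φ (Function.update a i c) = 0 then 1 / 2 else 1)))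
    {ρ : ℝ} (hρ : 1 < ρ) {a b : D → F} (hab : a ≠ b) :
    ∀ᶠ τ in 𝓝[>] (0 : ℝ), Real.exp (φ b / τ) * chain (accept τ) b a
      ≤ ρ * (Real.exp (φ a / τ) * chain (accept τ) a b) := by
  have hnn : ∀ τ a b, 0 ≤ chain (accept τ) a b := fun τ =>
    chain_nonneg (fun i a c => (hpos τ i a c).le) (hle τ)
  by_cases hdev : ∃ i c, b = Function.update a i c
  · obtain ⟨i, c, rfl⟩ := hdev
    have hc : c ≠ a i := by
      rintro rfl
      exact hab (Function.update_eq_self i a).symm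
    have hc' : a i ≠ Function.update a i c i := by rw [Function.update_self]; exact hc.symm
    have hback : Function.update (Function.update a i c) i (a i) = a := by simp
    set b := Function.update a i c with hb
    have hf := h i a c hc
    have hg := h i b (a i) hc'
    rw [hback] at hg
    rw [← hb] at hf
    set L : ℝ := if φ a - φ b = 0 then 1 / 2 else 1 with hL
    -- The limiting constants of the two directions agree, so the ratio of the normalized acceptance
    -- probabilities tends to 1.
    have hL' : (if φ b - φ a = 0 then (1 : ℝ) / 2 else 1) = L := by
      rw [hL, ← neg_sub (φ a) (φ b)]
      simp only [neg_eq_zero]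
    rw [hL'] at hg
    have hL0 : L ≠ 0 := by rw [hL]; split_ifs <;> norm_num
    have hq := hg.div hf hL0
    rw [div_self hL0] at hq
    filter_upwards [hq.eventually_lt_const hρ] with τ hτ
    have hab' := chain_apply_update (accept := accept τ) a i c hc
    rw [← hb] at hab'
    have hba := chain_apply_update (accept := accept τ) b i (a i) hc'
    rw [hback] at hba
    rw [hab', hba]
    simp only [Pi.div_apply] at hτ
    rw [div_lt_iff₀ (div_pos (hpos τ i a c) (Real.exp_pos _)), div_lt_iff₀ (Real.exp_pos _)] at hτ
    -- Both exponents equal min(φ a, φ b)/τ.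
    have hexp : Real.exp (φ b / τ) * Real.exp (-(max 0 (φ b - φ a)) / τ)
        = Real.exp (φ a / τ) * Real.exp (-(max 0 (φ a - φ b)) / τ) := by
      rw [← Real.exp_add, ← Real.exp_add, ← add_div, ← add_div]
      congr 2
      rcases le_total (φ a) (φ b) with hle | hle
      · rw [max_eq_right (by linarith), max_eq_left (by linarith)]
        ring
      · rw [max_eq_left (by linarith), max_eq_right (by linarith)]
        ring
    have hkey : Real.exp (φ b / τ) * accept τ i b (a i)
        ≤ ρ * (Real.exp (φ a / τ) * accept τ i a c) := by
      calc Real.exp (φ b / τ) * accept τ i b (a i)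
          ≤ Real.exp (φ b / τ) * (ρ * (accept τ i a c / Real.exp (-(max 0 (φ a - φ b)) / τ))
              * Real.exp (-(max 0 (φ b - φ a)) / τ)) :=
            mul_le_mul_of_nonneg_left hτ.le (Real.exp_pos _).le
        _ = ρ * (accept τ i a c / Real.exp (-(max 0 (φ a - φ b)) / τ))
              * (Real.exp (φ b / τ) * Real.exp (-(max 0 (φ b - φ a)) / τ)) := by ring
        _ = ρ * (Real.exp (φ a / τ) * accept τ i a c) := by
            rw [hexp]
            field_simp
    have hk : 0 ≤ 1 / ((Fintype.card D : ℝ) * (Fintype.card F : ℝ)) := by positivity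
    calc _ = 1 / ((Fintype.card D : ℝ) * (Fintype.card F : ℝ))
          * (Real.exp (φ b / τ) * accept τ i b (a i)) := by ring
      _ ≤ _ := mul_le_mul_of_nonneg_left hkey hk
      _ = _ := by ring
  -- Unilateral deviation is a symmetric relation, so the reverse transition has probability zero as
  -- well.
  · push Not at hdev
    refine Eventually.of_forall fun τ => ?_
    rw [chain_apply_eq_zero hab, mul_zero]
    · exact mul_nonneg (by linarith) (mul_nonneg (Real.exp_pos _).le (hnn τ a b))
    · rintro i c rfl
      exact hdev i (b i) (by simp)

end Game

end BLLA

/-! ### Stochastic stability of the noisy dynamics -/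

theorem theorem1 {D F Ω : Type*} [Fintype D] [DecidableEq D] [Nonempty D]
    [Fintype F] [DecidableEq F] [Nonempty F]
    [MeasurableSpace Ω] (μ : Measure Ω) [IsProbabilityMeasure μ]
    -- i.i.d. samples of the data rates, with finite expectation
    (rate : ℕ → Ω → D → F → Finset D → ℝ)
    (h_meas : ∀ k, Measurable (rate k))
    (h_indep : iIndepFun rate μ)
    (h_ident : ∀ k, IdentDistrib (rate k) (rate 0) μ μ)
    (h_int : ∀ (j : D) (c : F) (S : Finset D), Integrable (fun ω => rate 0 ω j c S) μ)
    -- the parameter of the bounds, and the number of samples used at temperature `τ`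
    (ξ : ℝ) (hξ0 : 0 < ξ) (hξ1 : ξ < 1)
    (N : ℝ → ℕ) (hN : ∀ τ, 0 < τ → 0 < N τ)
    (h_cond : (∃ ℓ : ℝ, BLLA.BoundedNoiseCondition μ rate ξ N ℓ) ∨
      BLLA.MGFNoiseCondition μ rate ξ N) :
    -- the chain has exactly one stationary distribution at each temperature
    (∀ τ, 0 < τ → ∃! p : (D → F) → ℝ,
      BLLA.IsStationary (BLLA.chain (BLLA.noisyAccept μ rate (N τ) τ)) p) ∧
    -- the stationary probabilities converge as the temperature goes to zero
    (∀ p : ℝ → (D → F) → ℝ,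
      (∀ τ, 0 < τ → BLLA.IsStationary (BLLA.chain (BLLA.noisyAccept μ rate (N τ) τ)) (p τ)) →
        ∀ a : D → F, ∃ L : ℝ, Tendsto (fun τ => p τ a) (𝓝[>] (0 : ℝ)) (𝓝 L)) ∧
    -- the stochastically stable states are exactly the global maximizers of the potential
    (∀ a : D → F,
      BLLA.StochasticallyStable (fun τ => BLLA.chain (BLLA.noisyAccept μ rate (N τ) τ)) a ↔
        ∀ b : D → F, BLLA.potential μ rate b ≤ BLLA.potential μ rate a) ∧
    -- the noisy and the noiseless transition probabilities have the same resistances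
    (∀ (i : D) (a : D → F) (c : F), c ≠ a i →
      BLLA.HasResistance
          (fun τ => BLLA.chain (BLLA.noisyAccept μ rate (N τ) τ) a (Function.update a i c))
          (max 0 (BLLA.meanUtility μ rate i a
            - BLLA.meanUtility μ rate i (Function.update a i c))) ∧
      BLLA.HasResistance
          (fun τ => BLLA.chain (BLLA.exactAccept μ rate τ) a (Function.update a i c))
          (max 0 (BLLA.meanUtility μ rate i a
            - BLLA.meanUtility μ rate i (Function.update a i c)))) := by
  have hacc : ∀ (i : D) (a : D → F) (c : F), c ≠ a i →
      Tendsto (fun τ => BLLA.noisyAccept μ rate (N τ) τ i a c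
        / Real.exp (-(max 0 (BLLA.meanUtility μ rate i a
          - BLLA.meanUtility μ rate i (Function.update a i c))) / τ)) (𝓝[>] 0)
      (𝓝 (if BLLA.meanUtility μ rate i a - BLLA.meanUtility μ rate i (Function.update a i c) = 0
        then 1 / 2 else 1)) := by
    intro i a c hc
    obtain ⟨hexp, hlim⟩ := h_cond.elim
      (fun ⟨ℓ, h⟩ => BLLA.tendsto_mgf_noise_of_bounded h_meas h_int hξ0 hξ1 h hc)
      (fun h => BLLA.tendsto_mgf_noise_of_mgf h_int hξ0 hξ1 h hc)
    exact BLLA.tendsto_noisyAccept_div_exp h_meas h_indep h_ident hN hexp hlim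
  have hpos := fun τ => BLLA.noisyAccept_pos (μ := μ) h_meas (N τ) τ
  have hle := fun τ => BLLA.noisyAccept_le_one (μ := μ) h_meas (N τ) τ
  have hP := fun τ => BLLA.chain_nonneg (fun i a c => (hpos τ i a c).le) (hle τ)
  have hsum := fun τ => BLLA.sum_chain (accept := BLLA.noisyAccept μ rate (N τ) τ)
  have hcut := fun τ => BLLA.crossesCuts_chain (hpos τ)
  have hex := fun τ => BLLA.exists_isStationary (hP τ) (hsum τ)
  -- The limit is fixed before the stationary family `p`, so whichever family witnesses stochastic
  -- stability has this limit.
  have hlim : ∀ a : D → F, ∃ L : ℝ, (0 < L ↔ ∀ b, BLLA.potential μ rate b ≤ BLLA.potential μ rate a) ∧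
      ∀ p : ℝ → (D → F) → ℝ,
        (∀ τ, 0 < τ → BLLA.IsStationary (BLLA.chain (BLLA.noisyAccept μ rate (N τ) τ)) (p τ)) →
          Tendsto (fun τ => p τ a) (𝓝[>] (0 : ℝ)) (𝓝 L) := by
    intro a
    obtain ⟨L, hL, hiff⟩ := BLLA.exists_tendsto_gibbs (BLLA.potential μ rate) a
    refine ⟨L, hiff, fun p hp => ?_⟩
    refine BLLA.tendsto_stationary_of_asymptotically_reversible _ (fun τ _ => hP τ)
      (fun τ _ => hsum τ) (fun τ _ => hcut τ) (fun ρ hρ a b hab => ?_) hp a hL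
    refine BLLA.eventually_chain_almost_reversible
      (accept := fun τ => BLLA.noisyAccept μ rate (N τ) τ) hpos hle (fun i a c hc => ?_) hρ hab
    simpa only [BLLA.meanUtility_sub_meanUtility h_int] using hacc i a c hc
  refine ⟨fun τ _ => ?_, fun p hp a => ?_, fun a => ?_, fun i a c hc => ?_⟩
  · obtain ⟨p, hp⟩ := hex τ
    exact ⟨p, hp, fun q hq => hq.unique (hP τ) (hcut τ) hp⟩
  · obtain ⟨L, -, h⟩ := hlim a
    exact ⟨L, h p hp⟩
  · obtain ⟨L, hiff, h⟩ := hlim a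
    rw [← hiff]
    constructor
    · rintro ⟨p, hp, L', hL', hlim'⟩
      rwa [tendsto_nhds_unique (h p hp) hlim']
    · intro hL
      choose p hp using hex
      exact ⟨p, fun τ _ => hp τ, L, hL, h p fun τ _ => hp τ⟩
  · exact ⟨BLLA.hasResistance_chain (accept := fun τ => BLLA.noisyAccept μ rate (N τ) τ) hc
        (hacc i a c hc),
      BLLA.hasResistance_chain (accept := fun τ => BLLA.exactAccept μ rate τ) hc
        (BLLA.tendsto_exactAccept_div_exp i a c)⟩
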